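/- Let $K$ be a field of characteristic zero, $n\ge 0$, and let $q_1,\dots,q_n\in K\setminus\{0\}$. Let $Q_n$ be the $n$-th $\underline q$-Weyl algebra, i.e. the $K$-algebra generated by $x_1,\dots,x_n,\partial_1,\dots,\partial_n$ with relations $x_ix_j=x_jx_i$, $\partial_i\partial_j=\partial_j\partial_i$ for all $i,j$, $\partial_ix_j=x_j\partial_i$ for $i\ne j$, and $\partial_ix_i=q_ix_i\partial_i+1$; for $q_1=\dots=q_n=1$ it is the Weyl algebra $A_n$. Put $\theta_i=x_i\partial_i$, and let $K[\theta]=K[\theta_1,\dots,\theta_n]\subseteq Q_n$ be the (commutative) subalgebra generated by $\theta_1,\dots,\theta_n$. Fix a monomial order on the commutative monomials in $\theta_1,\dots,\theta_n$; an element of $K[\theta]$ is monic if it is the value at $\theta_1,\dots,\theta_n$ of a polynomial with leading coefficient $1$. An element of a ring is reducible if it is nonzero, not a unit, and a product of two nonunits. 1. The monic irreducible elements of $K[\theta]$ that are reducible in $Q_n$ are exactly the elements $\theta_i$ and $\theta_i+\frac1{q_i}$, $1\le i\le n$. In particular, in $A_n$ they are exactly the elements $\theta_i$ and $\theta_i+1$,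 $1\le i\le n$. 2. One has $\theta_i=x_i\cdot\partial_i$ and $\theta_i+\frac1{q_i}=\frac1{q_i}\,\partial_i\cdot x_i$ in $Q_n$; in $A_n$ the latter reads $\theta_i+1=\partial_i\cdot x_i$. 3. Let $p\in Q_n$ be homogeneous of degree $0$, i.e. a $K$-linear combination of monomials $x_1^{a_1}\cdots x_n^{a_n}\partial_1^{a_1}\cdots\partial_n^{a_n}$. Then $p\in K[\theta]$, and if $p\ne0$ then $p=c\,f_1\cdots f_r$ with $c\in K\setminus\{0\}$, $r \ge 0$ and monic irreducible elements $f_1,\dots,f_r$ of $K[\theta]$. For every such commutative factorization, replacing each factor $f_k=\theta_i$ by the two factors $x_i,\partial_i$, and each factor $f_k=\theta_i+\frac1{q_i}$ by the two factors $\partial_i,x_i$ while multiplying the constant $c$ by $\frac1{q_i}$, yields a factorization of $p$ in $Q_n$ all of whose non-constant factors are irreducible in $Q_n$. In $A_n$ the same holds with $\theta_i+1=\partial_i\cdot x_i$ in place of $\theta_i+\frac1{q_i}$ and with the constant $c$ unchanged. -/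

import Mathlib

/-- The defining relations of the `n`-th `q`-Weyl algebra, on the free algebra with generators
`x i = ι (inl i)` and `∂ i = ι (inr i)`. -/
inductive QWeylRel {K : Type*} [Field K] {n : ℕ} (q : Fin n → Kˣ) :
    FreeAlgebra K (Fin n ⊕ Fin n) → FreeAlgebra K (Fin n ⊕ Fin n) → Prop
  | x_comm (i j : Fin n) : QWeylRel q
      (FreeAlgebra.ι K (Sum.inl i) * FreeAlgebra.ι K (Sum.inl j))
      (FreeAlgebra.ι K (Sum.inl j) * FreeAlgebra.ι K (Sum.inl i))
  | d_comm (i j : Fin n) : QWeylRel q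
      (FreeAlgebra.ι K (Sum.inr i) * FreeAlgebra.ι K (Sum.inr j))
      (FreeAlgebra.ι K (Sum.inr j) * FreeAlgebra.ι K (Sum.inr i))
  | d_x_ne (i j : Fin n) (h : i ≠ j) : QWeylRel q
      (FreeAlgebra.ι K (Sum.inr i) * FreeAlgebra.ι K (Sum.inl j))
      (FreeAlgebra.ι K (Sum.inl j) * FreeAlgebra.ι K (Sum.inr i))
  | d_x (i : Fin n) : QWeylRel q
      (FreeAlgebra.ι K (Sum.inr i) * FreeAlgebra.ι K (Sum.inl i))
      ((q i : K) • (FreeAlgebra.ι K (Sum.inl i) * FreeAlgebra.ι K (Sum.inr i)) + 1)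

/-- The `n`-th `q`-Weyl algebra `Q_n` over `K`, with parameters `q_1, …, q_n ∈ Kˣ`. -/
abbrev QWeylAlgebra {K : Type*} [Field K] {n : ℕ} (q : Fin n → Kˣ) : Type _ :=
  RingQuot (QWeylRel q)

namespace QWeylAlgebra

/-- The generator `x_i`. -/
noncomputable def x {K : Type*} [Field K] {n : ℕ} (q : Fin n → Kˣ) (i : Fin n) :
    QWeylAlgebra q :=
  RingQuot.mkAlgHom K (QWeylRel q) (FreeAlgebra.ι K (Sum.inl i))

/-- The generator `∂_i`. -/
noncomputable def d {K : Type*} [Field K] {n : ℕ} (q : Fin n → Kˣ) (i : Fin n) :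
    QWeylAlgebra q :=
  RingQuot.mkAlgHom K (QWeylRel q) (FreeAlgebra.ι K (Sum.inr i))

/-- The Euler operator `θ_i = x_i ∂_i`. -/
noncomputable def theta {K : Type*} [Field K] {n : ℕ} (q : Fin n → Kˣ) (i : Fin n) :
    QWeylAlgebra q :=
  x q i * d q i

/-- The monomial `X^a D^b = x_1^{a_1} ⋯ x_n^{a_n} ∂_1^{b_1} ⋯ ∂_n^{b_n}`. -/
noncomputable def xdMonomial {K : Type*} [Field K] {n : ℕ} (q : Fin n → Kˣ) (a b : Fin n → ℕ) :
    QWeylAlgebra q :=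
  (List.ofFn fun i => x q i ^ a i).prod * (List.ofFn fun i => d q i ^ b i).prod

/-- The `z`-th graded part of `Q_n`, `z ∈ ℤⁿ`: the `K`-span of the monomials `X^a D^b` with
`b - a = z`. -/
noncomputable def gradedPart {K : Type*} [Field K] {n : ℕ} (q : Fin n → Kˣ) (z : Fin n → ℤ) :
    Submodule K (QWeylAlgebra q) :=
  Submodule.span K {p | ∃ a b : Fin n → ℕ, (∀ i, (b i : ℤ) - (a i : ℤ) = z i) ∧
    p = xdMonomial q a b}

/-- The subalgebra `K[θ_1, …, θ_n]` of `Q_n`. -/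
abbrev thetaAlgebra {K : Type*} [Field K] {n : ℕ} (q : Fin n → Kˣ) :
    Subalgebra K (QWeylAlgebra q) :=
  Algebra.adjoin K (Set.range (theta q))

theorem x_mul_x {K : Type*} [Field K] {n : ℕ} (q : Fin n → Kˣ) (i j : Fin n) :
    x q i * x q j = x q j * x q i := by
  simpa [x] using RingQuot.mkAlgHom_rel K (QWeylRel.x_comm (q := q) i j)

theorem d_mul_d {K : Type*} [Field K] {n : ℕ} (q : Fin n → Kˣ) (i j : Fin n) :
    d q i * d q j = d q j * d q i := by
  simpa [d] using RingQuot.mkAlgHom_rel K (QWeylRel.d_comm (q := q) i j)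

theorem d_mul_x_of_ne {K : Type*} [Field K] {n : ℕ} (q : Fin n → Kˣ) {i j : Fin n} (h : i ≠ j) :
    d q i * x q j = x q j * d q i := by
  simpa [x, d] using RingQuot.mkAlgHom_rel K (QWeylRel.d_x_ne (q := q) i j h)

theorem theta_mul_theta {K : Type*} [Field K] {n : ℕ} (q : Fin n → Kˣ) (i j : Fin n) :
    theta q i * theta q j = theta q j * theta q i := by
  rcases eq_or_ne i j with rfl | h
  · rfl
  · unfold theta
    calc x q i * d q i * (x q j * d q j)
        = x q i * (d q i * x q j) * d q j := by simp only [mul_assoc]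
      _ = (x q i * x q j) * (d q i * d q j) := by
        rw [d_mul_x_of_ne q h]; simp only [mul_assoc]
      _ = (x q j * x q i) * (d q j * d q i) := by rw [x_mul_x q i j, d_mul_d q i j]
      _ = x q j * (x q i * d q j) * d q i := by simp only [mul_assoc]
      _ = x q j * d q j * (x q i * d q i) := by
        rw [← d_mul_x_of_ne q h.symm]; simp only [mul_assoc]

/-- `K[θ_1, …, θ_n]` is a commutative ring. -/
noncomputable instance instCommRingThetaAlgebra {K : Type*} [Field K] {n : ℕ} (q : Fin n → Kˣ) :
    CommRing (thetaAlgebra q) :=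
  { (inferInstance : Ring (thetaAlgebra q)) with
    mul_comm := (Algebra.isMulCommutative_adjoin K (by
      rintro _ ⟨i, rfl⟩ _ ⟨j, rfl⟩
      exact theta_mul_theta q i j)).is_comm.comm }

/-- `θ_i` as an element of `K[θ_1, …, θ_n]`. -/
noncomputable def thetaGen {K : Type*} [Field K] {n : ℕ} (q : Fin n → Kˣ) (i : Fin n) :
    thetaAlgebra q :=
  ⟨theta q i, Algebra.subset_adjoin ⟨i, rfl⟩⟩

/-- `θ_i + 1/q_i` as an element of `K[θ_1, …, θ_n]`. -/
noncomputable def thetaShift {K : Type*} [Field K] {n : ℕ} (q : Fin n → Kˣ) (i : Fin n) :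
    thetaAlgebra q :=
  thetaGen q i + algebraMap K (thetaAlgebra q) (1 / (q i : K))

/-- `f ∈ K[θ_1, …, θ_n]` is monic with respect to the monomial order `m`: it is the value at
`θ_1, …, θ_n` of a commutative polynomial whose leading coefficient with respect to `m` is `1`. -/
def IsThetaMonic {K : Type*} [Field K] {n : ℕ} (q : Fin n → Kˣ) (m : MonomialOrder (Fin n))
    (f : thetaAlgebra q) : Prop :=
  ∃ P : MvPolynomial (Fin n) K, m.Monic P ∧ MvPolynomial.aeval (thetaGen q) P = f

/-- An element of a ring is reducible if it is nonzero, not a unit, and a product of two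
nonunits. -/
def IsReducible {R : Type*} [Ring R] (f : R) : Prop :=
  f ≠ 0 ∧ ¬ IsUnit f ∧ ∃ g h : R, ¬ IsUnit g ∧ ¬ IsUnit h ∧ f = g * h

/-- `p = c · f_1 ⋯ f_r` is a complete commutative factorization of `p` in `K[θ_1, …, θ_n]`:
`c ∈ K` is nonzero and `f_1, …, f_r` are monic irreducible elements of `K[θ_1, …, θ_n]`. -/
def IsThetaFactorization {K : Type*} [Field K] {n : ℕ} (q : Fin n → Kˣ)
    (m : MonomialOrder (Fin n)) (p : QWeylAlgebra q) (c : K) (L : List (thetaAlgebra q)) : Prop :=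
  c ≠ 0 ∧ (∀ f ∈ L, IsThetaMonic q m f ∧ Irreducible f) ∧
    p = c • ((L.prod : thetaAlgebra q) : QWeylAlgebra q)

open Classical in
/-- The list of factors in `Q_n` that replaces the factor `f ∈ K[θ_1, …, θ_n]`: `x_i, ∂_i` if
`f = θ_i`; `∂_i, x_i` if `f = θ_i + 1/q_i`; and `f` itself otherwise. -/
noncomputable def rewriteFactor {K : Type*} [Field K] {n : ℕ} (q : Fin n → Kˣ)
    (f : thetaAlgebra q) : List (QWeylAlgebra q) :=
  if h : ∃ i, f = thetaGen q i then [x q h.choose, d q h.choose]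
  else if h : ∃ i, f = thetaShift q i then [d q h.choose, x q h.choose]
  else [(f : QWeylAlgebra q)]

open Classical in
/-- The scalar that appears when `f` is replaced by the product of `rewriteFactor q f`: it is
`1/q_i` if `f = θ_i + 1/q_i = (1/q_i) ∂_i x_i`, and `1` otherwise. -/
noncomputable def rewriteScalar {K : Type*} [Field K] {n : ℕ} (q : Fin n → Kˣ)
    (f : thetaAlgebra q) : K :=
  if ∃ i, f = thetaGen q i then 1
  else if h : ∃ i, f = thetaShift q i then 1 / (q h.choose : K)
  else 1

end QWeylAlgebra

/-- The `n`-th Weyl algebra `A_n` over `K`: the case `q_1 = ⋯ = q_n = 1` of `Q_n`. -/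
abbrev weylParam (K : Type*) [Field K] (n : ℕ) : Fin n → Kˣ := fun _ => 1

/-! `Q_n` embeds by `toSkew` into the skew group algebra of `ℤⁿ` over the polynomial ring in the
`θ_i`: `x_i` goes to the group element `e_i`, and `∂_i` to its inverse with coefficient `q_i θ_i +
1`. Since `ℤⁿ` has two unique products and polynomials form a domain, every factor of a homogeneous
element is homogeneous (`exists_eq_single_of_mul_eq_single`).

A homogeneous element of degree `z` is `P(θ)` times a pure monomial in `x_i` (where `z_i > 0`) and
`∂_i` (where `z_i < 0`). Its weight `2 deg P + ∑ |z_i|` is additive, nonnegative, and zero only for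
scalars (`HasWeight.exists_eq`). Hence units have weight zero and elements of weight one, such as
`x_i` and `∂_i`, are irreducible.

Let `f` be irreducible in `K[θ]` and `f = g h` with nonunits of degrees `z` and `-z`. If `z = 0`,
both factors lie in `K[θ]`, a contradiction. Otherwise some `z_i ≠ 0`, and a letter `x_i` of one
factor can be brought next to a letter `∂_i` of the other: `f = u T(θ) v` with `T = θ_i` or `T = q_i
θ_i + 1`. Sliding `T` past `u` shifts it but keeps it nonconstant, so irreducibility makes `u v` a
unit and `f` a scalar multiple of `T` (`exists_eq_smul_of_isReducible`). The factorization statement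
follows, because any other irreducible factor stays irreducible in `Q_n`. -/

namespace QWeylAlgebra

/-! ### Affine shifts of the `θ_i` and the action of `ℤⁿ`. -/

open MvPolynomial

/-- The substitution `θ_i ↦ q_i⁻¹ (θ_i - 1)`, which fixes the other variables. -/
noncomputable def shiftEquiv {K : Type*} [Field K] {n : ℕ} (q : Fin n → Kˣ) (i : Fin n) :
    MvPolynomial (Fin n) K ≃ₐ[K] MvPolynomial (Fin n) K :=
  AlgEquiv.ofAlgHom
    (aeval (Function.update X i (C (q i : K)⁻¹ * (X i - 1))))
    (aeval (Function.update X i (C (q i : K) * X i + 1)))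
    (by
      ext1 j
      rcases eq_or_ne j i with rfl | h
      · simp [← mul_assoc, ← C_mul, algebraMap_eq]
      · simp [h])
    (by
      ext1 j
      rcases eq_or_ne j i with rfl | h
      · simp [← mul_assoc, ← C_mul, algebraMap_eq]
      · simp [h])

section

variable {K : Type*} [Field K] {n : ℕ} (q : Fin n → Kˣ)

@[simp]
theorem shiftEquiv_X_self (i : Fin n) : shiftEquiv q i (X i) = C (q i : K)⁻¹ * (X i - 1) := by
  simp [shiftEquiv]

@[simp]
theorem shiftEquiv_C (i : Fin n) (a : K) : shiftEquiv q i (C a) = C a :=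
  (shiftEquiv q i).commutes a

@[simp]
theorem shiftEquiv_symm_C (i : Fin n) (a : K) : (shiftEquiv q i).symm (C a) = C a :=
  (shiftEquiv q i).symm.commutes a

theorem shiftEquiv_X_of_ne {i j : Fin n} (h : j ≠ i) : shiftEquiv q i (X j) = X j := by
  simp [shiftEquiv, h]

theorem shiftEquiv_commute (i j : Fin n) : Commute (shiftEquiv q i) (shiftEquiv q j) := by
  rcases eq_or_ne i j with rfl | hij
  · exact Commute.refl _
  · apply AlgEquiv.coe_toAlgHom_injective
    ext1 k
    rcases eq_or_ne k i with rfl | hi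
    · simp [shiftEquiv_X_of_ne q hij]
    · rcases eq_or_ne k j with rfl | hj
      · simp [shiftEquiv_X_of_ne q hi]
      · simp [shiftEquiv_X_of_ne q hi, shiftEquiv_X_of_ne q hj]

theorem totalDegree_aeval_le {σ τ : Type*} (f : σ → MvPolynomial τ K)
    (hf : ∀ s, (f s).totalDegree ≤ 1) (P : MvPolynomial σ K) :
    (aeval f P).totalDegree ≤ P.totalDegree := by
  rw [aeval_def, eval₂_eq]
  refine totalDegree_finsetSum_le fun d hd => ?_
  refine (totalDegree_mul _ _).trans ?_
  rw [algebraMap_eq, totalDegree_C, zero_add]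
  refine (totalDegree_finsetProd _ _).trans (le_trans ?_ (le_totalDegree hd))
  refine Finset.sum_le_sum fun s _ => (totalDegree_pow _ _).trans ?_
  exact (Nat.mul_le_mul_left _ (hf s)).trans (by simp)

theorem totalDegree_update_X_le (i : Fin n) (P : MvPolynomial (Fin n) K)
    (hP : P.totalDegree ≤ 1) (j : Fin n) :
    (Function.update X i P j : MvPolynomial (Fin n) K).totalDegree ≤ 1 := by
  rcases eq_or_ne j i with rfl | h
  · simpa using hP
  · simp [h]

@[simp]
-- The substitution and its inverse are both affine, so neither can raise the degree.
theorem totalDegree_shiftEquiv (i : Fin n) (P : MvPolynomial (Fin n) K) :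
    (shiftEquiv q i P).totalDegree = P.totalDegree := by
  have key : ∀ a b : K, (C a * X i + C b : MvPolynomial (Fin n) K).totalDegree ≤ 1 := by
    intro a b
    refine (totalDegree_add _ _).trans (max_le ((totalDegree_mul _ _).trans ?_) (by simp))
    simp
  apply le_antisymm
  · refine totalDegree_aeval_le _ (totalDegree_update_X_le i _ ?_) P
    have := key (q i : K)⁻¹ (-(q i : K)⁻¹)
    rwa [C_neg, ← sub_eq_add_neg, ← mul_sub_one] at this
  · conv_lhs => rw [← (shiftEquiv q i).symm_apply_apply P]
    refine totalDegree_aeval_le _ (totalDegree_update_X_le i _ ?_) _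
    simpa using key (q i : K) 1

/-- The group `ℤⁿ` of degrees, written multiplicatively, acting on `K[θ_1, …, θ_n]` through
the substitutions `shiftEquiv q i`. -/
def DegreeGroup {K : Type*} [Field K] {n : ℕ} (_ : Fin n → Kˣ) : Type := Fin n → Multiplicative ℤ

instance : CommGroup (DegreeGroup q) := inferInstanceAs (CommGroup (Fin n → Multiplicative ℤ))

instance : TwoUniqueProds (DegreeGroup q) :=
  inferInstanceAs (TwoUniqueProds (Fin n → Multiplicative ℤ))

/-- The action of the group of degrees by iterated shifts. -/
noncomputable def shiftHom :
    DegreeGroup q →* (MvPolynomial (Fin n) K ≃ₐ[K] MvPolynomial (Fin n) K) :=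
  MonoidHom.noncommPiCoprod (N := fun _ => Multiplicative ℤ)
    (fun i => zpowersHom (MvPolynomial (Fin n) K ≃ₐ[K] MvPolynomial (Fin n) K) (shiftEquiv q i))
    (fun i j _ a b => (shiftEquiv_commute q i j).zpow_zpow a.toAdd b.toAdd)

/-- The action depends on `q`, which is why `DegreeGroup` keeps `q` as a parameter of the type. -/
noncomputable instance : MulSemiringAction (DegreeGroup q) (MvPolynomial (Fin n) K) :=
  MulSemiringAction.compHom _ (shiftHom q)

theorem degreeGroup_smul_def (z : DegreeGroup q) (P : MvPolynomial (Fin n) K) :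
    z • P = shiftHom q z P := rfl

instance : SMulCommClass (DegreeGroup q) K (MvPolynomial (Fin n) K) where
  smul_comm z a P := by simp [degreeGroup_smul_def]

theorem totalDegree_degree_smul (z : DegreeGroup q) (P : MvPolynomial (Fin n) K) :
    (z • P).totalDegree = P.totalDegree := by
  let H : Subgroup (MvPolynomial (Fin n) K ≃ₐ[K] MvPolynomial (Fin n) K) :=
    { carrier := {e | ∀ P, (e P).totalDegree = P.totalDegree}
      mul_mem' := fun ha hb P => by rw [AlgEquiv.mul_apply, ha, hb]
      one_mem' := fun P => rfl
      inv_mem' := fun {a} ha P => by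
        rw [← ha (a⁻¹ P), ← AlgEquiv.mul_apply, mul_inv_cancel, AlgEquiv.one_apply] }
  have : shiftHom q z ∈ H := by
    refine H.noncommProd_mem _ fun i _ => ?_
    rw [zpowersHom_apply]
    exact H.zpow_mem (totalDegree_shiftEquiv q i) _
  exact this P

/-- The degree of `x_i`. -/
def degreeGen (i : Fin n) : DegreeGroup q :=
  (Pi.mulSingle i (Multiplicative.ofAdd 1) : Fin n → Multiplicative ℤ)

theorem degreeGen_smul (i : Fin n) (P : MvPolynomial (Fin n) K) :
    degreeGen q i • P = shiftEquiv q i P := by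
  rw [degreeGroup_smul_def]
  unfold shiftHom degreeGen
  erw [MonoidHom.noncommPiCoprod_mulSingle]
  simp

theorem degreeGen_inv_smul (i : Fin n) (P : MvPolynomial (Fin n) K) :
    (degreeGen q i)⁻¹ • P = (shiftEquiv q i).symm P := by
  rw [inv_smul_eq_iff, degreeGen_smul, AlgEquiv.apply_symm_apply]

theorem shiftEquiv_symm_X_of_ne {i j : Fin n} (h : j ≠ i) :
    (shiftEquiv q i).symm (X j) = X j := by
  rw [AlgEquiv.symm_apply_eq, shiftEquiv_X_of_ne q h]

/-! ### The representation in the skew group algebra. -/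

/-- The skew group algebra of the group of degrees over `K[θ_1, …, θ_n]`. -/
abbrev SkewAlgebra {K : Type*} [Field K] {n : ℕ} (q : Fin n → Kˣ) : Type _ :=
  SkewMonoidAlgebra (MvPolynomial (Fin n) K) (DegreeGroup q)

theorem SkewAlgebra.single_mul_single (z w : DegreeGroup q) (P R : MvPolynomial (Fin n) K) :
    (SkewMonoidAlgebra.single z P * SkewMonoidAlgebra.single w R : SkewAlgebra q) =
      SkewMonoidAlgebra.single (z * w) (P * z • R) := by
  exact SkewMonoidAlgebra.single_mul_single

/-- The embedding of the `q`-Weyl algebra into the skew group algebra. -/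
noncomputable def toSkew : QWeylAlgebra q →ₐ[K] SkewAlgebra q :=
  RingQuot.liftAlgHom K ⟨FreeAlgebra.lift K (Sum.elim
    (fun i => SkewMonoidAlgebra.single (degreeGen q i) 1)
    (fun i => SkewMonoidAlgebra.single (degreeGen q i)⁻¹ (C (q i : K) * X i + 1))), by
    intro a b h
    induction h with
    | x_comm i j =>
      simp [mul_comm (degreeGen q i)]
    | d_comm i j =>
      rcases eq_or_ne i j with rfl | h
      · rfl
      simp only [map_mul, FreeAlgebra.lift_ι_apply, Sum.elim_inr, SkewAlgebra.single_mul_single,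
        degreeGen_inv_smul, map_add, map_one, shiftEquiv_symm_X_of_ne q h,
        shiftEquiv_symm_X_of_ne q h.symm, shiftEquiv_symm_C]
      rw [mul_comm (degreeGen q i)⁻¹, mul_comm (C (q i : K) * X i + 1)]
    | d_x_ne i j h =>
      simp only [map_mul, FreeAlgebra.lift_ι_apply, Sum.elim_inr, Sum.elim_inl,
        SkewAlgebra.single_mul_single, degreeGen_smul,
        map_add, map_one, shiftEquiv_X_of_ne q h, shiftEquiv_C, smul_one]
      rw [mul_comm (degreeGen q i)⁻¹, mul_comm (C (q i : K) * X i + 1)]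
    | d_x i =>
      simp only [map_mul, FreeAlgebra.lift_ι_apply, Sum.elim_inr, Sum.elim_inl, map_smul,
        SkewAlgebra.single_mul_single, degreeGen_smul, inv_mul_cancel, mul_inv_cancel,
        map_add, map_one, shiftEquiv_X_self, shiftEquiv_C, smul_one, SkewMonoidAlgebra.one_def,
        SkewMonoidAlgebra.smul_single, ← SkewMonoidAlgebra.single_add]
      congr 1
      rw [← mul_assoc, ← C_mul]
      simp [smul_eq_C_mul]⟩

theorem toSkew_x (i : Fin n) :
    toSkew q (x q i) = SkewMonoidAlgebra.single (degreeGen q i) 1 := by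
  simp [toSkew, x]

theorem toSkew_d (i : Fin n) :
    toSkew q (d q i) =
      SkewMonoidAlgebra.single (degreeGen q i)⁻¹ (C (q i : K) * X i + 1) := by
  simp [toSkew, d]

theorem toSkew_theta (i : Fin n) : toSkew q (theta q i) = SkewMonoidAlgebra.single 1 (X i) := by
  rw [theta, map_mul, toSkew_x, toSkew_d, SkewAlgebra.single_mul_single, mul_inv_cancel,
    degreeGen_smul, map_add, map_mul, shiftEquiv_C, shiftEquiv_X_self, ← mul_assoc, ← C_mul]
  simp

end

end QWeylAlgebra

/-! ### Homogeneity of the factors of a homogeneous element. -/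

namespace SkewMonoidAlgebra

/-- Only the pair `(a, b)` contributes to this coefficient of the convolution. -/
theorem coeff_mul_of_uniqueMul {k G : Type*} [Semiring k] [Monoid G] [MulSemiringAction G k]
    (f g : SkewMonoidAlgebra k G) {a b : G} (ha : a ∈ f.support) (hb : b ∈ g.support)
    (h : UniqueMul f.support g.support a b) :
    (f * g).coeff (a * b) = f.coeff a * a • g.coeff b := by
  classical
  rw [coeff_mul, sum_def', Finset.sum_eq_single_of_mem a ha, sum_def',
    Finset.sum_eq_single_of_mem b hb, if_pos rfl]
  · intro b' hb' hne
    rw [if_neg fun e => hne (h ha hb' e).2]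
  · intro a' ha' hne
    exact Finset.sum_eq_zero fun b' hb' => if_neg fun e => hne (h ha' hb' e).1

/-- Over a domain and a group with the two unique products property, the factors of a
homogeneous element are homogeneous. -/
theorem exists_eq_single_of_mul_eq_single {k G : Type*} [Semiring k] [NoZeroDivisors k] [Group G]
    [MulSemiringAction G k] [TwoUniqueProds G] {f g : SkewMonoidAlgebra k G} {z : G} {r : k}
    (hr : r ≠ 0) (h : f * g = single z r) :
    ∃ a b s t, f = single a s ∧ g = single b t := by
  have hfg : f * g ≠ 0 := by
    rw [h]
    exact fun h0 => hr (single_eq_zero.1 h0)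
  have hf : f.support.Nonempty := by
    rw [Finset.nonempty_iff_ne_empty, Ne, support_eq_empty]
    rintro rfl
    simp at hfg
  have hg : g.support.Nonempty := by
    rw [Finset.nonempty_iff_ne_empty, Ne, support_eq_empty]
    rintro rfl
    simp at hfg
  have single_of_card : ∀ u : SkewMonoidAlgebra k G, u.support.card = 1 → ∃ a s, u = single a s := by
    intro u hu
    obtain ⟨a, s, hs⟩ := Finsupp.card_support_eq_one'.1 hu
    exact ⟨a, s, coeff_injective hs.2⟩
  by_cases hc : 1 < f.support.card * g.support.card
  · obtain ⟨p₁, hp₁, p₂, hp₂, hne, hu₁, hu₂⟩ := TwoUniqueProds.uniqueMul_of_one_lt_card hc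
    rw [Finset.mem_product] at hp₁ hp₂
    -- A uniquely attained product has a nonzero coefficient in `f * g`, because `k` has no zero
    -- divisors; hence it must be `z`. Two distinct such pairs would then have the same product,
    -- against uniqueness.
    have key : ∀ p : G × G, p.1 ∈ f.support → p.2 ∈ g.support →
        UniqueMul f.support g.support p.1 p.2 → p.1 * p.2 = z := by
      intro p h1 h2 hu
      have := coeff_mul_of_uniqueMul f g h1 h2 hu
      rw [h, coeff_single] at this
      by_contra hz
      rw [Finsupp.single_eq_of_ne hz] at this
      rcases mul_eq_zero.1 this.symm with h0 | h0
      · exact mem_support_iff.1 h1 h0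
      · exact mem_support_iff.1 h2 (by simpa using (smul_eq_zero_iff_eq p.1).1 h0)
    have e := hu₁ hp₂.1 hp₂.2 ((key p₂ hp₂.1 hp₂.2 hu₂).trans (key p₁ hp₁.1 hp₁.2 hu₁).symm)
    exact absurd (Prod.ext e.1 e.2).symm hne
  · have h1 := hf.card_pos
    have h2 := hg.card_pos
    have hf1 : f.support.card = 1 := by nlinarith
    have hg1 : g.support.card = 1 := by nlinarith
    obtain ⟨a, s, hs⟩ := single_of_card f hf1
    obtain ⟨b, t, ht⟩ := single_of_card g hg1
    exact ⟨a, b, s, t, hs, ht⟩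

end SkewMonoidAlgebra

/-! ### Commutation of `x_i` and `∂_i` with polynomials in the `θ_i`. -/

namespace QWeylAlgebra

open MvPolynomial

variable {K : Type*} [Field K] {n : ℕ} (q : Fin n → Kˣ)

/-- The map `K[θ_1, …, θ_n] → Q_n` from commutative polynomials. -/
noncomputable def thetaHom : MvPolynomial (Fin n) K →ₐ[K] QWeylAlgebra q :=
  (thetaAlgebra q).val.comp (aeval (thetaGen q))

theorem coe_aeval_thetaGen (P : MvPolynomial (Fin n) K) :
    ((aeval (thetaGen q) P : thetaAlgebra q) : QWeylAlgebra q) = thetaHom q P := rfl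

@[simp]
theorem thetaHom_X (i : Fin n) : thetaHom q (X i) = theta q i := by
  simp [thetaHom, thetaGen]

theorem thetaHom_mem (P : MvPolynomial (Fin n) K) : thetaHom q P ∈ thetaAlgebra q :=
  (aeval (thetaGen q) P : thetaAlgebra q).2

theorem exists_thetaHom_eq {a : QWeylAlgebra q} (ha : a ∈ thetaAlgebra q) :
    ∃ P, thetaHom q P = a := by
  have : thetaAlgebra q ≤ (thetaHom q).range := by
    rw [Algebra.adjoin_le_iff]
    rintro _ ⟨i, rfl⟩
    exact ⟨X i, thetaHom_X q i⟩
  exact this ha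

theorem toSkew_thetaHom (P : MvPolynomial (Fin n) K) :
    toSkew q (thetaHom q P) = SkewMonoidAlgebra.single 1 P := by
  induction P using MvPolynomial.induction_on with
  | C a =>
    rw [← algebraMap_eq, AlgHom.commutes, AlgHom.commutes]
    rfl
  | add P R hP hR => rw [map_add, map_add, hP, hR, SkewMonoidAlgebra.single_add]
  | mul_X P i hP =>
    rw [map_mul, map_mul, hP, thetaHom_X, toSkew_theta, SkewAlgebra.single_mul_single]
    simp

theorem thetaHom_injective : Function.Injective (thetaHom q) := by
  intro P R h
  have := congrArg (toSkew q) h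
  rw [toSkew_thetaHom, toSkew_thetaHom] at this
  exact SkewMonoidAlgebra.single_injective _ this

theorem d_mul_x_self (i : Fin n) : d q i * x q i = (q i : K) • theta q i + 1 := by
  simpa [x, d, theta] using RingQuot.mkAlgHom_rel K (QWeylRel.d_x (q := q) i)

theorem d_mul_x_eq_thetaHom (i : Fin n) :
    d q i * x q i = thetaHom q (C (q i : K) * X i + 1) := by
  rw [d_mul_x_self, map_add, map_mul, map_one, thetaHom_X, ← algebraMap_eq, AlgHom.commutes,
    Algebra.smul_def]

/-- For `j = i`, multiply `∂_i x_i = q_i θ_i + 1` on the left by `x_i` and solve for `x_i θ_i`. -/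
theorem x_mul_theta (i j : Fin n) :
    x q i * theta q j = thetaHom q (shiftEquiv q i (X j)) * x q i := by
  rcases eq_or_ne j i with rfl | h
  · rw [shiftEquiv_X_self, map_mul, map_sub, thetaHom_X, map_one, ← algebraMap_eq, AlgHom.commutes,
      ← Algebra.smul_def, smul_mul_assoc, sub_mul, one_mul, theta, mul_assoc (x q j) (d q j),
      d_mul_x_self, mul_add, mul_one, add_sub_cancel_right, mul_smul_comm, smul_smul,
      inv_mul_cancel₀ (q j).ne_zero, one_smul, theta]
  · rw [shiftEquiv_X_of_ne q h, thetaHom_X, theta, ← mul_assoc, x_mul_x q i j, mul_assoc,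
      ← d_mul_x_of_ne q h, mul_assoc]

theorem x_mul_thetaHom (i : Fin n) (P : MvPolynomial (Fin n) K) :
    x q i * thetaHom q P = thetaHom q (shiftEquiv q i P) * x q i := by
  induction P using MvPolynomial.induction_on with
  | C a =>
    rw [shiftEquiv_C, ← algebraMap_eq, AlgHom.commutes, Algebra.commutes]
  | add P R hP hR => simp only [map_add, mul_add, add_mul, hP, hR]
  | mul_X P j hP =>
    rw [map_mul, map_mul, map_mul, ← mul_assoc, hP, mul_assoc, thetaHom_X, x_mul_theta, mul_assoc]

theorem d_mul_theta (i j : Fin n) :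
    d q i * theta q j = thetaHom q ((shiftEquiv q i).symm (X j)) * d q i := by
  rcases eq_or_ne j i with rfl | h
  · have : (shiftEquiv q j).symm (X j) = C (q j : K) * X j + 1 := by
      simp [shiftEquiv]
    rw [this, ← d_mul_x_eq_thetaHom, theta, mul_assoc]
  · rw [shiftEquiv_symm_X_of_ne q h, thetaHom_X, theta, ← mul_assoc, d_mul_x_of_ne q h.symm,
      mul_assoc, d_mul_d, mul_assoc]

theorem d_mul_thetaHom (i : Fin n) (P : MvPolynomial (Fin n) K) :
    d q i * thetaHom q P = thetaHom q ((shiftEquiv q i).symm P) * d q i := by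
  induction P using MvPolynomial.induction_on with
  | C a =>
    rw [shiftEquiv_symm_C, ← algebraMap_eq, AlgHom.commutes, Algebra.commutes]
  | add P R hP hR => simp only [map_add, mul_add, add_mul, hP, hR]
  | mul_X P j hP =>
    rw [map_mul, map_mul, map_mul, ← mul_assoc, hP, mul_assoc, thetaHom_X, d_mul_theta, mul_assoc]

/-! ### Normal form: polynomials in `θ` times signed monomials. -/

/-- The power `x_i ^ k` for `k ≥ 0`, and `∂_i ^ (-k)` for `k ≤ 0`. -/
noncomputable def signedPow (i : Fin n) (k : ℤ) : QWeylAlgebra q :=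
  x q i ^ k.toNat * d q i ^ (-k).toNat

theorem signedPow_of_nonneg (i : Fin n) {k : ℤ} (hk : 0 ≤ k) :
    signedPow q i k = x q i ^ k.toNat := by
  simp [signedPow, Int.toNat_of_nonpos (neg_nonpos.2 hk)]

theorem signedPow_of_nonpos (i : Fin n) {k : ℤ} (hk : k ≤ 0) :
    signedPow q i k = d q i ^ (-k).toNat := by
  simp [signedPow, Int.toNat_of_nonpos hk]

theorem signedPow_zero (i : Fin n) : signedPow q i 0 = 1 := by simp [signedPow]

/-- The sign condition rules out cancellation: for `k < 0` an extra factor from `K[θ]` would appear.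
-/
theorem signedPow_mul_x (i : Fin n) {k : ℤ} (hk : 0 ≤ k) :
    signedPow q i k * x q i = signedPow q i (k + 1) := by
  rw [signedPow_of_nonneg q i hk, signedPow_of_nonneg q i (by lia), ← pow_succ]
  congr 1
  lia

theorem x_mul_signedPow (i : Fin n) {k : ℤ} (hk : 0 ≤ k) :
    x q i * signedPow q i k = signedPow q i (k + 1) := by
  rw [signedPow_of_nonneg q i hk, signedPow_of_nonneg q i (by lia), ← pow_succ']
  congr 1
  lia

theorem signedPow_mul_d (i : Fin n) {k : ℤ} (hk : k ≤ 0) :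
    signedPow q i k * d q i = signedPow q i (k - 1) := by
  rw [signedPow_of_nonpos q i hk, signedPow_of_nonpos q i (by lia), ← pow_succ]
  congr 1
  lia

theorem d_mul_signedPow (i : Fin n) {k : ℤ} (hk : k ≤ 0) :
    d q i * signedPow q i k = signedPow q i (k - 1) := by
  rw [signedPow_of_nonpos q i hk, signedPow_of_nonpos q i (by lia), ← pow_succ']
  congr 1
  lia

theorem x_commute_signedPow {i j : Fin n} (h : i ≠ j) (k : ℤ) :
    Commute (x q i) (signedPow q j k) :=
  (Commute.pow_right (x_mul_x q i j) _).mul_right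
    (Commute.pow_right (d_mul_x_of_ne q h.symm).symm _)

theorem d_commute_signedPow {i j : Fin n} (h : i ≠ j) (k : ℤ) :
    Commute (d q i) (signedPow q j k) :=
  (Commute.pow_right (d_mul_x_of_ne q h) _).mul_right
    (Commute.pow_right (d_mul_d q i j) _)

theorem signedPow_commute {i j : Fin n} (h : i ≠ j) (k l : ℤ) :
    Commute (signedPow q i k) (signedPow q j l) :=
  ((x_commute_signedPow q h l).pow_left _).mul_left ((d_commute_signedPow q h l).pow_left _)

theorem signedPow_pairwise_commute (z : Fin n → ℤ) (s : Set (Fin n)) :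
    s.Pairwise (Function.onFun Commute fun i => signedPow q i (z i)) :=
  fun _ _ _ _ h => signedPow_commute q h _ _

/-- The product of the elements `signedPow q i (z i)`, which is `x_i ^ z_i` or `∂_i ^ (-z_i)`
according to the sign of `z_i`. -/
noncomputable def signedMonomial (z : Fin n → ℤ) : QWeylAlgebra q :=
  Finset.univ.noncommProd (fun i => signedPow q i (z i))
    (signedPow_pairwise_commute q z _)

theorem signedMonomial_zero : signedMonomial q 0 = 1 :=
  (Finset.noncommProd_eq_pow_card _ _ _ 1 fun i _ => signedPow_zero q i).trans (one_pow _)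

/-- The product of the elements `signedPow q j (z j)` with `j ≠ i`. -/
noncomputable def signedMonomialErase (z : Fin n → ℤ) (i : Fin n) : QWeylAlgebra q :=
  (Finset.univ.erase i).noncommProd (fun i => signedPow q i (z i))
    (signedPow_pairwise_commute q z _)

theorem signedMonomial_eq (z : Fin n → ℤ) (i : Fin n) :
    signedMonomial q z = signedPow q i (z i) * signedMonomialErase q z i :=
  (Finset.mul_noncommProd_erase _ (Finset.mem_univ i) _ _).symm

theorem signedMonomial_eq' (z : Fin n → ℤ) (i : Fin n) :
    signedMonomial q z = signedMonomialErase q z i * signedPow q i (z i) :=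
  (Finset.noncommProd_erase_mul _ (Finset.mem_univ i) _ _).symm

theorem signedMonomialErase_congr {z w : Fin n → ℤ} {i : Fin n} (h : ∀ j, j ≠ i → z j = w j) :
    signedMonomialErase q z i = signedMonomialErase q w i :=
  Finset.noncommProd_congr rfl (fun j hj => by rw [h j (Finset.ne_of_mem_erase hj)]) _

theorem x_mul_signedMonomial {z : Fin n → ℤ} {i : Fin n} (h : 0 ≤ z i) :
    x q i * signedMonomial q z = signedMonomial q (z + Pi.single i 1) := by
  rw [signedMonomial_eq q _ i, signedMonomial_eq q _ i, ← mul_assoc, x_mul_signedPow q i h,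
    signedMonomialErase_congr q (w := z) (z := z + _) fun j hj => by simp [hj]]
  simp

theorem signedMonomial_mul_x {z : Fin n → ℤ} {i : Fin n} (h : 0 ≤ z i) :
    signedMonomial q z * x q i = signedMonomial q (z + Pi.single i 1) := by
  rw [signedMonomial_eq' q _ i, signedMonomial_eq' q _ i, mul_assoc, signedPow_mul_x q i h,
    signedMonomialErase_congr q (w := z) (z := z + _) fun j hj => by simp [hj]]
  simp

theorem d_mul_signedMonomial {z : Fin n → ℤ} {i : Fin n} (h : z i ≤ 0) :
    d q i * signedMonomial q z = signedMonomial q (z - Pi.single i 1) := by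
  rw [signedMonomial_eq q _ i, signedMonomial_eq q _ i, ← mul_assoc, d_mul_signedPow q i h,
    signedMonomialErase_congr q (w := z) (z := z - _) fun j hj => by simp [hj]]
  simp

theorem signedMonomial_mul_d {z : Fin n → ℤ} {i : Fin n} (h : z i ≤ 0) :
    signedMonomial q z * d q i = signedMonomial q (z - Pi.single i 1) := by
  rw [signedMonomial_eq' q _ i, signedMonomial_eq' q _ i, mul_assoc, signedPow_mul_d q i h,
    signedMonomialErase_congr q (w := z) (z := z - _) fun j hj => by simp [hj]]
  simp

/-- The linear map `(P_z)_z ↦ ∑_z P_z(θ) · signedMonomial z`. -/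
noncomputable def ofComponents :
    ((Fin n → ℤ) →₀ MvPolynomial (Fin n) K) →ₗ[K] QWeylAlgebra q :=
  Finsupp.lsum K fun z => (LinearMap.mulRight K (signedMonomial q z)).comp (thetaHom q).toLinearMap

theorem ofComponents_single (z : Fin n → ℤ) (P : MvPolynomial (Fin n) K) :
    ofComponents q (Finsupp.single z P) = thetaHom q P * signedMonomial q z := by
  simp [ofComponents]

theorem x_mul_mem_range (i : Fin n) {u : QWeylAlgebra q} (hu : u ∈ (ofComponents q).range) :
    x q i * u ∈ (ofComponents q).range := by
  obtain ⟨F, rfl⟩ := hu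
  induction F using Finsupp.induction_linear with
  | zero => simp
  | add F G hF hG => rw [map_add, mul_add]; exact add_mem hF hG
  | single z P =>
    rw [ofComponents_single, ← mul_assoc, x_mul_thetaHom, mul_assoc]
    rcases le_or_gt 0 (z i) with h | h
    · exact ⟨_, (ofComponents_single q _ _).trans (by rw [x_mul_signedMonomial q h])⟩
    -- Here `x_i` meets a letter `∂_i`; the pair leaves the factor `θ_i = x_i ∂_i`.
    · refine ⟨Finsupp.single (z + Pi.single i 1) (shiftEquiv q i P * X i), ?_⟩
      rw [ofComponents_single, map_mul, thetaHom_X, mul_assoc, theta, mul_assoc (x q i),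
        d_mul_signedMonomial q (by simp; lia), add_sub_cancel_right]

theorem d_mul_mem_range (i : Fin n) {u : QWeylAlgebra q} (hu : u ∈ (ofComponents q).range) :
    d q i * u ∈ (ofComponents q).range := by
  obtain ⟨F, rfl⟩ := hu
  induction F using Finsupp.induction_linear with
  | zero => simp
  | add F G hF hG => rw [map_add, mul_add]; exact add_mem hF hG
  | single z P =>
    rw [ofComponents_single, ← mul_assoc, d_mul_thetaHom, mul_assoc]
    rcases le_or_gt (z i) 0 with h | h
    · exact ⟨_, (ofComponents_single q _ _).trans (by rw [d_mul_signedMonomial q h])⟩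
    -- Here `∂_i` meets a letter `x_i`; the pair leaves `∂_i x_i = q_i θ_i + 1`.
    · refine ⟨Finsupp.single (z - Pi.single i 1)
        ((shiftEquiv q i).symm P * (C (q i : K) * X i + 1)), ?_⟩
      rw [ofComponents_single, map_mul, ← d_mul_x_eq_thetaHom, mul_assoc, mul_assoc (d q i),
        x_mul_signedMonomial q (by simp; lia), sub_add_cancel]

/-- The range contains `1` and is stable under left multiplication by the generators, hence by all
of `Q_n`. -/
theorem ofComponents_surjective : Function.Surjective (ofComponents q) := by
  have key : ∀ (a : FreeAlgebra K (Fin n ⊕ Fin n)) (u : QWeylAlgebra q),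
      u ∈ (ofComponents q).range →
        RingQuot.mkAlgHom K (QWeylRel q) a * u ∈ (ofComponents q).range := by
    intro a
    induction a using FreeAlgebra.induction with
    | grade0 r =>
      intro u hu
      rw [AlgHom.commutes, ← Algebra.smul_def]
      exact Submodule.smul_mem _ _ hu
    | grade1 s =>
      intro u hu
      rcases s with i | i
      · exact x_mul_mem_range q i hu
      · exact d_mul_mem_range q i hu
    | mul a b ha hb =>
      intro u hu
      rw [map_mul, mul_assoc]
      exact ha _ (hb _ hu)
    | add a b ha hb =>
      intro u hu
      rw [map_add, add_mul]
      exact add_mem (ha _ hu) (hb _ hu)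
  intro g
  obtain ⟨a, rfl⟩ := RingQuot.mkAlgHom_surjective K (QWeylRel q) g
  have := key a 1 ⟨Finsupp.single 0 1, by
    rw [ofComponents_single, signedMonomial_zero, map_one, mul_one]⟩
  rw [mul_one] at this
  exact this

end QWeylAlgebra

/-! ### Weights, units and irreducibility of homogeneous elements. -/

namespace QWeylAlgebra

open MvPolynomial

variable {K : Type*} [Field K] {n : ℕ} (q : Fin n → Kˣ)

/-- An integer vector as an element of the group of degrees. -/
def toDegree (z : Fin n → ℤ) : DegreeGroup q :=
  (fun i => Multiplicative.ofAdd (z i) : Fin n → Multiplicative ℤ)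

theorem toDegree_add (z w : Fin n → ℤ) : toDegree q (z + w) = toDegree q z * toDegree q w := rfl

theorem toDegree_neg (z : Fin n → ℤ) : toDegree q (-z) = (toDegree q z)⁻¹ := rfl

theorem toDegree_single (i : Fin n) : toDegree q (Pi.single i 1) = degreeGen q i := by
  funext j
  rcases eq_or_ne j i with rfl | h
  · simp [toDegree, degreeGen]
  · simp [toDegree, degreeGen, h]

theorem toDegree_injective : Function.Injective (toDegree q) := fun _ _ h =>
  funext fun i => Multiplicative.ofAdd.injective (congrFun h i)

theorem toDegree_surjective : Function.Surjective (toDegree q) := fun g =>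
  ⟨fun i => (show Fin n → Multiplicative ℤ from g) i |>.toAdd, rfl⟩

/-- The element `u` is nonzero, homogeneous of multidegree `z` (with `x_i` of degree `e_i` and
`∂_i` of degree `-e_i`) and of total degree `d` in the generators. -/
def HasWeight (u : QWeylAlgebra q) (z : Fin n → ℤ) (d : ℤ) : Prop :=
  ∃ M : MvPolynomial (Fin n) K, M ≠ 0 ∧ toSkew q u = SkewMonoidAlgebra.single (toDegree q z) M ∧
    d = 2 * M.totalDegree + ∑ i, z i

variable {q}

/-- Total degree is additive over a domain and unchanged by shifts. -/
theorem HasWeight.mul {u v : QWeylAlgebra q} {z w : Fin n → ℤ} {d e : ℤ}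
    (hu : HasWeight q u z d) (hv : HasWeight q v w e) : HasWeight q (u * v) (z + w) (d + e) := by
  obtain ⟨M, hM, hu, rfl⟩ := hu
  obtain ⟨N, hN, hv, rfl⟩ := hv
  have hN' : toDegree q z • N ≠ 0 := by rwa [Ne, smul_eq_zero_iff_eq]
  refine ⟨M * toDegree q z • N, mul_ne_zero hM hN', ?_, ?_⟩
  · rw [map_mul, hu, hv, SkewAlgebra.single_mul_single, toDegree_add]
  · rw [totalDegree_mul_of_isDomain hM hN', totalDegree_degree_smul]
    simp only [Pi.add_apply, Finset.sum_add_distrib]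
    push_cast
    ring

theorem HasWeight.unique {u : QWeylAlgebra q} {z w : Fin n → ℤ} {d e : ℤ}
    (hu : HasWeight q u z d) (hv : HasWeight q u w e) : z = w ∧ d = e := by
  obtain ⟨M, hM, hu, rfl⟩ := hu
  obtain ⟨N, hN, hv, rfl⟩ := hv
  rw [hu] at hv
  have hc := congrArg SkewMonoidAlgebra.coeff hv
  rw [SkewMonoidAlgebra.coeff_single, SkewMonoidAlgebra.coeff_single,
    Finsupp.single_eq_single_iff] at hc
  rcases hc with ⟨h1, rfl⟩ | ⟨h1, -⟩
  · obtain rfl := toDegree_injective q h1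
    exact ⟨rfl, rfl⟩
  · exact absurd h1 hM

theorem hasWeight_thetaHom {P : MvPolynomial (Fin n) K} (hP : P ≠ 0) :
    HasWeight q (thetaHom q P) 0 (2 * P.totalDegree) :=
  ⟨P, hP, toSkew_thetaHom q P, by simp⟩

theorem hasWeight_one : HasWeight q (1 : QWeylAlgebra q) 0 0 := by
  simpa using hasWeight_thetaHom (q := q) (one_ne_zero (α := MvPolynomial (Fin n) K))

theorem hasWeight_x (i : Fin n) : HasWeight q (x q i) (Pi.single i 1) 1 :=
  ⟨1, one_ne_zero, by rw [toSkew_x, toDegree_single], by simp⟩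

theorem totalDegree_C_mul_X_add_C {σ : Type*} {a : K} (ha : a ≠ 0) (b : K) (i : σ) :
    (C a * X i + C b : MvPolynomial σ K).totalDegree = 1 := by
  have h : (C a * X i : MvPolynomial σ K).totalDegree = 1 := by
    rw [totalDegree_mul_of_isDomain (by simpa using ha) (X_ne_zero i)]
    simp
  rw [totalDegree_add_eq_left_of_totalDegree_lt (by simp [h]), h]

/-- The coefficient of degree one contributes `2` and the multidegree `-1`, so `∂_i` weighs as much
as `x_i`. -/
theorem hasWeight_d (i : Fin n) : HasWeight q (d q i) (-Pi.single i 1) 1 := by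
  have h := totalDegree_C_mul_X_add_C (q i).ne_zero (1 : K) i
  rw [C_1] at h
  refine ⟨_, ?_, by rw [toSkew_d, toDegree_neg, toDegree_single], ?_⟩
  · intro h0
    simp [h0] at h
  · simp [h]

theorem HasWeight.pow {u : QWeylAlgebra q} {z : Fin n → ℤ} {d : ℤ}
    (hu : HasWeight q u z d) (k : ℕ) : HasWeight q (u ^ k) (k • z) (k • d) := by
  induction k with
  | zero => simpa using hasWeight_one
  | succ k ih =>
    rw [pow_succ, succ_nsmul, succ_nsmul]
    exact ih.mul hu

theorem hasWeight_signedPow (i : Fin n) (k : ℤ) :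
    HasWeight q (signedPow q i k) (Pi.single i k) |k| := by
  have h := ((hasWeight_x (q := q) i).pow k.toNat).mul ((hasWeight_d (q := q) i).pow (-k).toNat)
  have h1 : k.toNat • Pi.single i 1 + (-k).toNat • -Pi.single i 1 = (Pi.single i k : Fin n → ℤ) := by
    funext j
    rcases eq_or_ne j i with rfl | hj
    · simp
      lia
    · simp [hj]
  have h2 : k.toNat • (1 : ℤ) + (-k).toNat • (1 : ℤ) = |k| := by
    simp only [nsmul_eq_mul, mul_one]
    rcases abs_cases k with ⟨h, _⟩ | ⟨h, _⟩ <;> rw [h] <;> lia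
  rwa [h1, h2] at h

theorem hasWeight_signedMonomial (z : Fin n → ℤ) :
    HasWeight q (signedMonomial q z) z (∑ i, |z i|) := by
  have key : ∀ s : Finset (Fin n), HasWeight q
      (s.noncommProd (fun i => signedPow q i (z i)) (signedPow_pairwise_commute q z _))
      (∑ i ∈ s, Pi.single i (z i)) (∑ i ∈ s, |z i|) := by
    intro s
    induction s using Finset.induction_on with
    | empty => simpa only [Finset.noncommProd_empty, Finset.sum_empty] using hasWeight_one
    | insert a s ha ih =>
      rw [Finset.noncommProd_insert_of_notMem _ _ _ _ ha, Finset.sum_insert ha,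
        Finset.sum_insert ha]
      exact (hasWeight_signedPow a (z a)).mul ih
  have := key Finset.univ
  rwa [Finset.univ_sum_single] at this

/-- Signed monomials of different degrees land in different homogeneous pieces, so `toSkew` is
diagonal in the normal form. Its diagonal entries are nonzero, which yields both the uniqueness of
components and the injectivity of `toSkew`. -/
theorem toSkew_ofComponents_coeff (F : (Fin n → ℤ) →₀ MvPolynomial (Fin n) K) (z : Fin n → ℤ)
    {M : MvPolynomial (Fin n) K}
    (hM : toSkew q (signedMonomial q z) = SkewMonoidAlgebra.single (toDegree q z) M) :
    (toSkew q (ofComponents q F)).coeff (toDegree q z) = F z * M := by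
  induction F using Finsupp.induction_linear with
  | zero => simp
  | add F G hF hG => simp [hF, hG, add_mul]
  | single w P =>
    rw [ofComponents_single, map_mul, toSkew_thetaHom]
    rcases eq_or_ne w z with rfl | h
    · rw [hM, SkewAlgebra.single_mul_single, one_mul, one_smul]
      simp
    · obtain ⟨N, -, hN, -⟩ := hasWeight_signedMonomial (q := q) w
      rw [hN, SkewAlgebra.single_mul_single, one_mul, one_smul, SkewMonoidAlgebra.coeff_single,
        Finsupp.single_eq_of_ne ((toDegree_injective q).ne h.symm), Finsupp.single_eq_of_ne h.symm,
        zero_mul]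

/-- A homogeneous element is the product of an element of `K[θ]` and a `signedMonomial`. -/
theorem exists_eq_thetaHom_mul {u : QWeylAlgebra q} {z : Fin n → ℤ} {M : MvPolynomial (Fin n) K}
    (hu : toSkew q u = SkewMonoidAlgebra.single (toDegree q z) M) :
    ∃ P, u = thetaHom q P * signedMonomial q z := by
  obtain ⟨F, rfl⟩ := ofComponents_surjective q u
  refine ⟨F z, ?_⟩
  rw [← ofComponents_single]
  congr 1
  ext1 w
  rcases eq_or_ne w z with rfl | h
  · simp
  · rw [Finsupp.single_eq_of_ne h]
    obtain ⟨N, hN0, hN, -⟩ := hasWeight_signedMonomial (q := q) w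
    have := toSkew_ofComponents_coeff F w hN
    rw [hu, SkewMonoidAlgebra.coeff_single,
      Finsupp.single_eq_of_ne ((toDegree_injective q).ne h)] at this
    exact (mul_eq_zero.1 this.symm).resolve_right hN0

theorem toSkew_injective : Function.Injective (toSkew q) := by
  rw [injective_iff_map_eq_zero]
  intro u hu
  obtain ⟨F, rfl⟩ := ofComponents_surjective q u
  have : F = 0 := by
    ext1 w
    obtain ⟨N, hN0, hN, -⟩ := hasWeight_signedMonomial (q := q) w
    have := toSkew_ofComponents_coeff F w hN
    rw [hu] at this
    exact (mul_eq_zero.1 this.symm).resolve_right hN0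
  rw [this, map_zero]

theorem HasWeight.exists_of_mul {u v : QWeylAlgebra q} {z : Fin n → ℤ} {d : ℤ}
    (h : HasWeight q (u * v) z d) :
    ∃ z₁ z₂ d₁ d₂, HasWeight q u z₁ d₁ ∧ HasWeight q v z₂ d₂ ∧ z₁ + z₂ = z ∧ d₁ + d₂ = d := by
  obtain ⟨M, hM, huv, hd⟩ := id h
  rw [map_mul] at huv
  obtain ⟨a, b, s, t, hs, ht⟩ := SkewMonoidAlgebra.exists_eq_single_of_mul_eq_single hM huv
  obtain ⟨z₁, rfl⟩ := toDegree_surjective q a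
  obtain ⟨z₂, rfl⟩ := toDegree_surjective q b
  have hs0 : s ≠ 0 := by
    rintro rfl
    rw [hs, SkewMonoidAlgebra.single_zero, zero_mul] at huv
    exact hM (SkewMonoidAlgebra.single_eq_zero.1 huv.symm)
  have ht0 : t ≠ 0 := by
    rintro rfl
    rw [ht, SkewMonoidAlgebra.single_zero, mul_zero] at huv
    exact hM (SkewMonoidAlgebra.single_eq_zero.1 huv.symm)
  have h1 : HasWeight q u z₁ _ := ⟨s, hs0, hs, rfl⟩
  have h2 : HasWeight q v z₂ _ := ⟨t, ht0, ht, rfl⟩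
  obtain ⟨e1, e2⟩ := (h1.mul h2).unique h
  exact ⟨_, _, _, _, h1, h2, e1, e2⟩

theorem HasWeight.ne_zero {u : QWeylAlgebra q} {z : Fin n → ℤ} {d : ℤ}
    (h : HasWeight q u z d) : u ≠ 0 := by
  rintro rfl
  obtain ⟨M, hM, hu, -⟩ := h
  rw [map_zero] at hu
  exact hM (SkewMonoidAlgebra.single_eq_zero.1 hu.symm)

/-- The normal form turns `2 deg M + ∑ z_i`, whose sign is not apparent, into a visibly nonnegative
expression. -/
theorem HasWeight.exists_eq {u : QWeylAlgebra q} {z : Fin n → ℤ} {d : ℤ}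
    (h : HasWeight q u z d) : ∃ P : MvPolynomial (Fin n) K, P ≠ 0 ∧
      u = thetaHom q P * signedMonomial q z ∧ d = 2 * P.totalDegree + ∑ i, |z i| := by
  obtain ⟨M, hM, hu, -⟩ := id h
  obtain ⟨P, rfl⟩ := exists_eq_thetaHom_mul hu
  have hP : P ≠ 0 := by
    rintro rfl
    exact h.ne_zero (by simp)
  exact ⟨P, hP, rfl, (h.unique ((hasWeight_thetaHom hP).mul (hasWeight_signedMonomial z))).2⟩

theorem HasWeight.nonneg {u : QWeylAlgebra q} {z : Fin n → ℤ} {d : ℤ}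
    (h : HasWeight q u z d) : 0 ≤ d := by
  obtain ⟨P, -, -, rfl⟩ := h.exists_eq
  positivity

theorem HasWeight.exists_eq_algebraMap {u : QWeylAlgebra q} {z : Fin n → ℤ}
    (h : HasWeight q u z 0) : z = 0 ∧ ∃ c : K, c ≠ 0 ∧ u = algebraMap K _ c := by
  obtain ⟨P, hP, rfl, hd⟩ := h.exists_eq
  have h1 : 0 ≤ ∑ i, |z i| := by positivity
  have h2 : P.totalDegree = 0 := by lia
  have h3 : ∑ i, |z i| = 0 := by lia
  rw [Finset.sum_eq_zero_iff_of_nonneg fun i _ => abs_nonneg _] at h3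
  have hz : z = 0 := funext fun i => abs_eq_zero.1 (h3 i (Finset.mem_univ i))
  refine ⟨hz, P.coeff 0, ?_, ?_⟩
  · intro h0
    rw [totalDegree_eq_zero_iff_eq_C.1 h2, h0, C_0] at hP
    exact hP rfl
  · rw [hz, signedMonomial_zero, mul_one, totalDegree_eq_zero_iff_eq_C.1 h2, ← algebraMap_eq,
      AlgHom.commutes]
    simp

theorem isUnit_algebraMap {c : K} (hc : c ≠ 0) :
    IsUnit (algebraMap K (QWeylAlgebra q) c) := (IsUnit.mk0 c hc).map _

/-- An inverse is again homogeneous, and two nonnegative weights with sum zero both vanish. -/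
theorem HasWeight.isUnit_iff {u : QWeylAlgebra q} {z : Fin n → ℤ} {d : ℤ}
    (h : HasWeight q u z d) : IsUnit u ↔ d = 0 := by
  constructor
  · intro hu
    obtain ⟨v, hv⟩ := hu.exists_right_inv
    have h1 : HasWeight q (u * v) 0 0 := hv ▸ hasWeight_one
    obtain ⟨z₁, z₂, d₁, d₂, hu, hv, -, hd⟩ := h1.exists_of_mul
    have := (hu.unique h).2
    have := hu.nonneg
    have := hv.nonneg
    lia
  · rintro rfl
    obtain ⟨-, c, hc, rfl⟩ := h.exists_eq_algebraMap
    exact isUnit_algebraMap hc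

/-- A homogeneous element of total degree one is irreducible. -/
theorem HasWeight.irreducible {u : QWeylAlgebra q} {z : Fin n → ℤ}
    (h : HasWeight q u z 1) : Irreducible u := by
  refine ⟨fun hu => one_ne_zero (h.isUnit_iff.1 hu), fun a b hab => ?_⟩
  rw [hab] at h
  obtain ⟨z₁, z₂, d₁, d₂, ha, hb, -, hd⟩ := h.exists_of_mul
  rw [ha.isUnit_iff, hb.isUnit_iff]
  have := ha.nonneg
  have := hb.nonneg
  lia

theorem irreducible_x (i : Fin n) : Irreducible (x q i) := (hasWeight_x i).irreducible

theorem irreducible_d (i : Fin n) : Irreducible (d q i) := (hasWeight_d i).irreducible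

theorem mem_thetaAlgebra_of_hasWeight {u : QWeylAlgebra q} {d : ℤ}
    (h : HasWeight q u 0 d) : u ∈ thetaAlgebra q := by
  obtain ⟨P, -, rfl, -⟩ := h.exists_eq
  rw [signedMonomial_zero, mul_one]
  exact thetaHom_mem q P

/-- Evenness is the point: inside `K[θ]` a weight `2` cannot split as `1 + 1`, though in `Q_n` it
can. -/
theorem hasWeight_coe {a : thetaAlgebra q} (ha : a ≠ 0) :
    ∃ k : ℕ, HasWeight q (a : QWeylAlgebra q) 0 (2 * k) := by
  obtain ⟨P, hP⟩ := exists_thetaHom_eq q a.2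
  rw [← hP]
  refine ⟨_, hasWeight_thetaHom ?_⟩
  rintro rfl
  exact ha (Subtype.ext (by rw [← hP, map_zero]; rfl))

/-- An element of `K[θ]` is a unit there as soon as it is a unit of `Q_n`. -/
theorem isUnit_of_isUnit_coe {a : thetaAlgebra q} (h : IsUnit (a : QWeylAlgebra q)) :
    IsUnit a := by
  have ha : a ≠ 0 := by
    rintro rfl
    have h1 := hasWeight_one (q := q)
    obtain ⟨v, hv⟩ := h.exists_right_inv
    exact h1.ne_zero (by rw [← hv]; simp)
  obtain ⟨k, hk⟩ := hasWeight_coe ha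
  have h0 := hk.isUnit_iff.1 h
  rw [h0] at hk
  obtain ⟨-, c, hc, hac⟩ := hk.exists_eq_algebraMap
  have : a = algebraMap K (thetaAlgebra q) c := Subtype.ext hac
  rw [this]
  exact (IsUnit.mk0 c hc).map (algebraMap K (thetaAlgebra q))

theorem isUnit_coe {a : thetaAlgebra q} (h : IsUnit a) : IsUnit (a : QWeylAlgebra q) :=
  h.map (thetaAlgebra q).val

/-- An element of `K[θ]` of total degree two in `Q_n` is irreducible in `K[θ]`. -/
theorem irreducible_of_hasWeight_two {a : thetaAlgebra q} {z : Fin n → ℤ}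
    (h : HasWeight q (a : QWeylAlgebra q) z 2) : Irreducible a := by
  refine ⟨fun hu => two_ne_zero (h.isUnit_iff.1 (isUnit_coe hu)), fun b c hbc => ?_⟩
  have hb : b ≠ 0 := by
    rintro rfl
    exact h.ne_zero (by rw [hbc]; simp)
  have hc : c ≠ 0 := by
    rintro rfl
    exact h.ne_zero (by rw [hbc]; simp)
  obtain ⟨k, hk⟩ := hasWeight_coe hb
  obtain ⟨l, hl⟩ := hasWeight_coe hc
  rw [hbc] at h
  have e := ((hk.mul hl).unique h).2
  have : k = 0 ∨ l = 0 := by lia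
  rcases this with rfl | rfl
  · exact Or.inl (isUnit_of_isUnit_coe (hk.isUnit_iff.2 (by simp)))
  · exact Or.inr (isUnit_of_isUnit_coe (hl.isUnit_iff.2 (by simp)))

end QWeylAlgebra

/-! ### Irreducibles of `K[θ]` that become reducible in `Q_n`. -/

namespace QWeylAlgebra

open MvPolynomial

variable {K : Type*} [Field K] {n : ℕ} {q : Fin n → Kˣ}

theorem HasWeight.mul_thetaHom {u : QWeylAlgebra q} {z : Fin n → ℤ} {d : ℤ}
    (h : HasWeight q u z d) (P : MvPolynomial (Fin n) K) :
    u * thetaHom q P = thetaHom q (toDegree q z • P) * u := by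
  obtain ⟨M, -, hu, -⟩ := h
  apply toSkew_injective
  rw [map_mul, map_mul, hu, toSkew_thetaHom, toSkew_thetaHom, SkewAlgebra.single_mul_single,
    SkewAlgebra.single_mul_single, mul_one, one_mul, one_smul, mul_comm M]

/-- If an irreducible element of `K[θ]` is `u T(θ) v` with `T` nonconstant and `u`, `v`
homogeneous, then `u` and `v` are scalars. -/
theorem eq_smul_of_eq_mul_thetaHom_mul {f : thetaAlgebra q} (hf : Irreducible f)
    {u v : QWeylAlgebra q} {z : Fin n → ℤ} {d e : ℤ} {T : MvPolynomial (Fin n) K}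
    (hT : T.totalDegree ≠ 0) (hu : HasWeight q u z d) (hv : HasWeight q v (-z) e)
    (h : (f : QWeylAlgebra q) = u * thetaHom q T * v) :
    ∃ c : K, c ≠ 0 ∧ (f : QWeylAlgebra q) = c • thetaHom q T := by
  have huv := hu.mul hv
  rw [add_neg_cancel] at huv
  have hzT : toDegree q z • T ≠ 0 := by
    rw [Ne, smul_eq_zero_iff_eq]
    rintro rfl
    simp at hT
  -- Sliding `T` to the left past `u` leaves `u * v`, which has degree zero and so lies in `K[θ]`.
  have hf' : f = ⟨thetaHom q (toDegree q z • T), thetaHom_mem q _⟩ *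
      ⟨u * v, mem_thetaAlgebra_of_hasWeight huv⟩ := by
    apply Subtype.ext
    rw [h, hu.mul_thetaHom, mul_assoc]
    rfl
  -- The shifted `T` is still nonconstant, hence no unit, so the unit must be `u * v`.
  have hde : d + e = 0 := by
    rcases hf.isUnit_or_isUnit hf' with h1 | h1
    · have := (hasWeight_thetaHom hzT).isUnit_iff.1 (isUnit_coe h1)
      rw [totalDegree_degree_smul] at this
      lia
    · exact huv.isUnit_iff.1 (isUnit_coe h1)
  have hd := hu.nonneg
  have he := hv.nonneg
  obtain rfl : d = 0 := by lia
  obtain rfl : e = 0 := by lia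
  obtain ⟨-, c, hc, rfl⟩ := hu.exists_eq_algebraMap
  obtain ⟨-, c', hc', rfl⟩ := hv.exists_eq_algebraMap
  refine ⟨c * c', mul_ne_zero hc hc', ?_⟩
  rw [h, ← Algebra.commutes, ← mul_assoc, ← map_mul, ← Algebra.smul_def, mul_comm]

/-- An irreducible element of `K[θ]` which is a product of two nonunits of `Q_n` is a scalar
multiple of `θ_i = x_i ∂_i` or of `q_i θ_i + 1 = ∂_i x_i`. -/
theorem exists_eq_smul_of_isReducible {f : thetaAlgebra q} (hf : Irreducible f)
    (hred : IsReducible (f : QWeylAlgebra q)) :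
    ∃ (i : Fin n) (c : K), c ≠ 0 ∧ ((f : QWeylAlgebra q) = c • thetaHom q (X i) ∨
      (f : QWeylAlgebra q) = c • thetaHom q (C (q i : K) * X i + 1)) := by
  obtain ⟨-, -, g, h, hg, hh, hfgh⟩ := hred
  obtain ⟨k, hk⟩ := hasWeight_coe hf.ne_zero
  rw [hfgh] at hk
  obtain ⟨z, w, d₁, d₂, hgz, hhw, hzw, -⟩ := hk.exists_of_mul
  obtain rfl : w = -z := (neg_eq_of_add_eq_zero_right hzw).symm
  by_cases hz : z = 0
  · subst hz
    rw [neg_zero] at hhw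
    have hf' : f = ⟨g, mem_thetaAlgebra_of_hasWeight hgz⟩ *
        ⟨h, mem_thetaAlgebra_of_hasWeight hhw⟩ := Subtype.ext hfgh
    rcases hf.isUnit_or_isUnit hf' with h1 | h1
    · exact absurd (isUnit_coe h1) hg
    · exact absurd (isUnit_coe h1) hh
  · obtain ⟨i, hi⟩ := Function.ne_iff.1 hz
    rw [Pi.zero_apply] at hi
    obtain ⟨P, hP, rfl, -⟩ := hgz.exists_eq
    obtain ⟨R, hR, rfl, -⟩ := hhw.exists_eq
    refine ⟨i, ?_⟩
    rcases lt_or_gt_of_ne hi with hi | hi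
    -- For `z i < 0` the last `∂_i` of `g` meets the first `x_i` of `h`, once `R` is moved to the
    -- right of that `x_i`; the middle is `∂_i x_i`.
    · have h1 : signedMonomial q z = signedMonomial q (z + Pi.single i 1) * d q i := by
        rw [signedMonomial_mul_d q (by simp; lia), add_sub_cancel_right]
      have h2 : signedMonomial q (-z) = x q i * signedMonomial q (-(z + Pi.single i 1)) := by
        rw [x_mul_signedMonomial q (by simp; lia), neg_add, neg_add_cancel_right]
      have hR' : (shiftEquiv q i).symm R ≠ 0 := by simpa using hR
      have hRx : thetaHom q R * x q i = x q i * thetaHom q ((shiftEquiv q i).symm R) := by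
        rw [x_mul_thetaHom, AlgEquiv.apply_symm_apply]
      have hT : (C (q i : K) * X i + 1 : MvPolynomial (Fin n) K).totalDegree ≠ 0 := by
        rw [← C_1, totalDegree_C_mul_X_add_C (q i).ne_zero]
        exact one_ne_zero
      have hu := (hasWeight_thetaHom (q := q) hP).mul
        (hasWeight_signedMonomial (z + Pi.single i 1))
      have hv := (hasWeight_thetaHom (q := q) hR').mul
        (hasWeight_signedMonomial (-(z + Pi.single i 1)))
      rw [zero_add] at hu hv
      obtain ⟨c, hc, hfc⟩ := eq_smul_of_eq_mul_thetaHom_mul hf hT hu hv (by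
        rw [hfgh, h1, h2, ← mul_assoc (thetaHom q R), hRx, ← d_mul_x_eq_thetaHom]
        simp only [mul_assoc])
      exact ⟨c, hc, Or.inr hfc⟩
    -- Mirror case, with middle `x_i ∂_i`.
    · have h1 : signedMonomial q z = signedMonomial q (z - Pi.single i 1) * x q i := by
        rw [signedMonomial_mul_x q (by simp; lia), sub_add_cancel]
      have h2 : signedMonomial q (-z) = d q i * signedMonomial q (-(z - Pi.single i 1)) := by
        rw [d_mul_signedMonomial q (by simp; lia), neg_sub', sub_neg_eq_add, add_sub_cancel_right]
      have hR' : shiftEquiv q i R ≠ 0 := by simpa using hR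
      have hRd : thetaHom q R * d q i = d q i * thetaHom q (shiftEquiv q i R) := by
        rw [d_mul_thetaHom, AlgEquiv.symm_apply_apply]
      have hu := (hasWeight_thetaHom (q := q) hP).mul
        (hasWeight_signedMonomial (z - Pi.single i 1))
      have hv := (hasWeight_thetaHom (q := q) hR').mul
        (hasWeight_signedMonomial (-(z - Pi.single i 1)))
      rw [zero_add] at hu hv
      obtain ⟨c, hc, hfc⟩ := eq_smul_of_eq_mul_thetaHom_mul hf (T := X i) (by simp) hu hv (by
        rw [hfgh, h1, h2, ← mul_assoc (thetaHom q R), hRd, thetaHom_X, theta]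
        simp only [mul_assoc])
      exact ⟨c, hc, Or.inl hfc⟩

theorem aeval_thetaGen_injective :
    Function.Injective (aeval (R := K) (thetaGen q)) := fun _ _ h =>
  thetaHom_injective q (congrArg Subtype.val h)

/-- A monic element of `K[θ]` that is a scalar multiple of a monic polynomial in the `θ_i` is
equal to it. -/
theorem IsThetaMonic.eq_aeval {m : MonomialOrder (Fin n)} {f : thetaAlgebra q}
    (hf : IsThetaMonic q m f) {c : K} {P : MvPolynomial (Fin n) K} (hP : m.Monic P)
    (h : (f : QWeylAlgebra q) = c • thetaHom q P) : f = aeval (thetaGen q) P := by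
  obtain ⟨R, hR, rfl⟩ := hf
  rw [coe_aeval_thetaGen, ← map_smul, (thetaHom_injective q).eq_iff] at h
  have hc := hR.leadingCoeff_eq_one
  rw [h, smul_eq_C_mul, m.leadingCoeff_mul, m.leadingCoeff_C, hP.leadingCoeff_eq_one,
    mul_one] at hc
  rw [h, hc, one_smul]

theorem aeval_X_add_C (i : Fin n) :
    aeval (thetaGen q) (X i + C (1 / (q i : K))) = thetaShift q i := by
  rw [map_add, aeval_X, ← algebraMap_eq, AlgHom.commutes, thetaShift]

theorem theta_add_eq (i : Fin n) : theta q i + algebraMap K (QWeylAlgebra q) (1 / (q i : K)) =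
    (1 / (q i : K)) • (d q i * x q i) := by
  rw [d_mul_x_self, smul_add, smul_smul, one_div, inv_mul_cancel₀ (q i).ne_zero, one_smul,
    Algebra.algebraMap_eq_smul_one]

theorem coe_thetaShift (i : Fin n) :
    (thetaShift q i : QWeylAlgebra q) = (1 / (q i : K)) • (d q i * x q i) := theta_add_eq i

theorem coe_thetaShift_eq_mul (i : Fin n) :
    (thetaShift q i : QWeylAlgebra q) = algebraMap K _ (1 / (q i : K)) * d q i * x q i := by
  rw [coe_thetaShift, Algebra.smul_def, mul_assoc]

theorem hasWeight_thetaGen (i : Fin n) : HasWeight q (thetaGen q i : QWeylAlgebra q) 0 2 := by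
  have h := (hasWeight_x (q := q) i).mul (hasWeight_d i)
  rwa [add_neg_cancel] at h

theorem hasWeight_algebraMap {c : K} (hc : c ≠ 0) :
    HasWeight q (algebraMap K (QWeylAlgebra q) c) 0 0 := by
  have h := hasWeight_thetaHom (q := q) (P := C c) (by simpa using hc)
  rwa [← algebraMap_eq, AlgHom.commutes, algebraMap_eq, totalDegree_C] at h

theorem one_div_unit_ne_zero (i : Fin n) : 1 / (q i : K) ≠ 0 := one_div_ne_zero (q i).ne_zero

theorem hasWeight_algebraMap_mul_d (i : Fin n) :
    HasWeight q (algebraMap K _ (1 / (q i : K)) * d q i) (-Pi.single i 1) 1 := by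
  simpa only [zero_add] using (hasWeight_algebraMap (one_div_unit_ne_zero (q := q) i)).mul
    (hasWeight_d i)

theorem hasWeight_thetaShift (i : Fin n) :
    HasWeight q (thetaShift q i : QWeylAlgebra q) 0 2 := by
  have h := (hasWeight_algebraMap_mul_d (q := q) i).mul (hasWeight_x i)
  rwa [neg_add_cancel, ← coe_thetaShift_eq_mul] at h

theorem isReducible_of_mul {R : Type*} [Ring R] {f g h : R} (hf : f ≠ 0) (hu : ¬ IsUnit f)
    (hg : ¬ IsUnit g) (hh : ¬ IsUnit h) (e : f = g * h) : IsReducible f :=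
  ⟨hf, hu, g, h, hg, hh, e⟩

theorem isReducible_thetaGen (i : Fin n) : IsReducible (thetaGen q i : QWeylAlgebra q) :=
  isReducible_of_mul (hasWeight_thetaGen i).ne_zero
    (fun h => two_ne_zero ((hasWeight_thetaGen i).isUnit_iff.1 h))
    (irreducible_x i).not_isUnit (irreducible_d i).not_isUnit rfl

theorem isReducible_thetaShift (i : Fin n) : IsReducible (thetaShift q i : QWeylAlgebra q) :=
  isReducible_of_mul (hasWeight_thetaShift i).ne_zero
    (fun h => two_ne_zero ((hasWeight_thetaShift i).isUnit_iff.1 h))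
    (hasWeight_algebraMap_mul_d i).irreducible.not_isUnit (irreducible_x i).not_isUnit
    (coe_thetaShift_eq_mul i)

/-- The monic irreducible elements of `K[θ]` that are reducible in `Q_n`. -/
theorem monic_irreducible_isReducible_iff (m : MonomialOrder (Fin n)) (f : thetaAlgebra q) :
    IsThetaMonic q m f ∧ Irreducible f ∧ IsReducible (f : QWeylAlgebra q) ↔
      ∃ i, f = thetaGen q i ∨ f = thetaShift q i := by
  constructor
  · rintro ⟨hm, hirr, hred⟩
    obtain ⟨i, c, -, h | h⟩ := exists_eq_smul_of_isReducible hirr hred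
    · exact ⟨i, Or.inl ((hm.eq_aeval m.monic_X h).trans (aeval_X _ i))⟩
    -- The constant comes from `q_i θ_i + 1 = q_i (θ_i + 1/q_i)`.
    · refine ⟨i, Or.inr ((hm.eq_aeval (m.monic_X_add_C i (1 / (q i : K)))
        (c := c * q i) ?_).trans (aeval_X_add_C i))⟩
      rw [h, mul_smul, ← map_smul (thetaHom q) (q i : K)]
      congr 2
      rw [smul_eq_C_mul, mul_add, ← C_mul, mul_one_div_cancel (q i).ne_zero, C_1]
  · rintro ⟨i, rfl | rfl⟩
    · exact ⟨⟨X i, m.monic_X, aeval_X _ i⟩, irreducible_of_hasWeight_two (hasWeight_thetaGen i),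
        isReducible_thetaGen i⟩
    · exact ⟨⟨_, m.monic_X_add_C i _, aeval_X_add_C i⟩,
        irreducible_of_hasWeight_two (hasWeight_thetaShift i), isReducible_thetaShift i⟩

/-! ### Elements of degree zero and the rewriting of their factorizations. -/

theorem hasWeight_prod_ofFn {k : ℕ} (f : Fin k → QWeylAlgebra q) (z : Fin k → Fin n → ℤ)
    (e : Fin k → ℤ) (h : ∀ j, HasWeight q (f j) (z j) (e j)) :
    HasWeight q (List.ofFn f).prod (∑ j, z j) (∑ j, e j) := by
  induction k with
  | zero => simpa using hasWeight_one
  | succ k ih =>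
    rw [List.ofFn_succ, List.prod_cons, Fin.sum_univ_succ, Fin.sum_univ_succ]
    exact (h 0).mul (ih _ _ _ fun j => h j.succ)

/-- `gradedPart` and `HasWeight` use opposite signs for the degree, which is harmless in degree
zero. -/
theorem gradedPart_zero_le : gradedPart q 0 ≤ Subalgebra.toSubmodule (thetaAlgebra q) := by
  refine Submodule.span_le.2 ?_
  rintro _ ⟨a, b, hab, rfl⟩
  have h := (hasWeight_prod_ofFn _ _ _ fun i => (hasWeight_x (q := q) i).pow (a i)).mul
    (hasWeight_prod_ofFn _ _ _ fun i => (hasWeight_d (q := q) i).pow (b i))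
  rw [← Finset.sum_add_distrib, Finset.sum_eq_zero] at h
  · exact mem_thetaAlgebra_of_hasWeight h
  · intro i _
    have : a i = b i := by
      have := hab i
      simp only [Pi.zero_apply] at this
      lia
    rw [this, smul_neg, add_neg_cancel]

/-- The algebra `K[θ]` is a polynomial algebra. -/
noncomputable def thetaEquiv (q : Fin n → Kˣ) :
    MvPolynomial (Fin n) K ≃ₐ[K] thetaAlgebra q :=
  AlgEquiv.ofBijective (aeval (thetaGen q)) ⟨aeval_thetaGen_injective, fun a => by
    obtain ⟨P, hP⟩ := exists_thetaHom_eq q a.2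
    exact ⟨P, Subtype.ext hP⟩⟩

/-- Polynomials factor into irreducibles; dividing each by its leading coefficient makes it monic,
and these scalars are collected in `c`. -/
theorem exists_isThetaFactorization (m : MonomialOrder (Fin n)) {P : MvPolynomial (Fin n) K}
    (hP : P ≠ 0) : ∃ c L, IsThetaFactorization q m (thetaHom q P) c L := by
  induction P using WfDvdMonoid.induction_on_irreducible with
  | zero => exact absurd rfl hP
  | unit u hu =>
    obtain ⟨c, hc, rfl⟩ := MvPolynomial.isUnit_iff_eq_C_of_isReduced.1 hu
    refine ⟨c, [], hc.ne_zero, by simp, ?_⟩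
    rw [← algebraMap_eq, AlgHom.commutes, Algebra.algebraMap_eq_smul_one]
    rfl
  | mul a i ha hi ih =>
    obtain ⟨c, L, hc, hL, hprod⟩ := ih ha
    have hl : m.leadingCoeff i ≠ 0 := by simpa using hi.ne_zero
    have hmonic : m.Monic (C (m.leadingCoeff i)⁻¹ * i) := by
      rw [MonomialOrder.Monic, m.leadingCoeff_mul, m.leadingCoeff_C, inv_mul_cancel₀ hl]
    have hirr : Irreducible (C (m.leadingCoeff i)⁻¹ * i) :=
      (irreducible_isUnit_mul ((IsUnit.mk0 _ (inv_ne_zero hl)).map C)).2 hi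
    have hi' : i = m.leadingCoeff i • (C (m.leadingCoeff i)⁻¹ * i) := by
      rw [smul_eq_C_mul, ← mul_assoc, ← C_mul, mul_inv_cancel₀ hl, C_1, one_mul]
    refine ⟨m.leadingCoeff i * c, thetaEquiv q (C (m.leadingCoeff i)⁻¹ * i) :: L,
      mul_ne_zero hl hc, ?_, ?_⟩
    · intro f hf
      rcases List.mem_cons.1 hf with rfl | hf
      · exact ⟨⟨_, hmonic, rfl⟩, (MulEquiv.irreducible_iff (thetaEquiv q)).2 hirr⟩
      · exact hL f hf
    · rw [map_mul, hprod, List.prod_cons]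
      conv_lhs => rw [hi']
      rw [map_smul, smul_mul_smul_comm]
      rfl

theorem rewriteScalar_smul_prod (f : thetaAlgebra q) :
    rewriteScalar q f • (rewriteFactor q f).prod = (f : QWeylAlgebra q) := by
  unfold rewriteScalar rewriteFactor
  by_cases h : ∃ i, f = thetaGen q i
  · rw [if_pos h, dif_pos h, one_smul]
    conv_rhs => rw [h.choose_spec]
    simp [thetaGen, theta]
  · rw [if_neg h, dif_neg h]
    by_cases h' : ∃ i, f = thetaShift q i
    -- Scalar and factor list choose their index from the same existential, so uniqueness of `i` is
    -- not needed.
    · rw [dif_pos h', dif_pos h']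
      conv_rhs => rw [h'.choose_spec, coe_thetaShift]
      simp
    · rw [dif_neg h', dif_neg h']
      simp

theorem coe_prod_eq_smul_prod_flatMap (L : List (thetaAlgebra q)) :
    ((L.prod : thetaAlgebra q) : QWeylAlgebra q) =
      (L.map (rewriteScalar q)).prod • (L.flatMap (rewriteFactor q)).prod := by
  induction L with
  | nil => simp
  | cons f L ih =>
    rw [List.prod_cons, List.map_cons, List.prod_cons, List.flatMap_cons, List.prod_append,
      ← smul_mul_smul_comm, rewriteScalar_smul_prod, ← ih]
    rfl

/-- The letters have weight one; a factor left unchanged is covered by the classification, since a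
proper factorization would make it one of the exceptions. -/
theorem irreducible_of_mem_rewriteFactor {m : MonomialOrder (Fin n)} {f : thetaAlgebra q}
    (hm : IsThetaMonic q m f) (hf : Irreducible f) {g : QWeylAlgebra q}
    (hg : g ∈ rewriteFactor q f) : Irreducible g := by
  unfold rewriteFactor at hg
  split_ifs at hg with h h'
  · rcases List.mem_pair.1 hg with rfl | rfl
    · exact irreducible_x _
    · exact irreducible_d _
  · rcases List.mem_pair.1 hg with rfl | rfl
    · exact irreducible_d _
    · exact irreducible_x _
  · obtain rfl := List.mem_singleton.1 hg
    obtain ⟨k, hk⟩ := hasWeight_coe hf.ne_zero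
    have hu : ¬ IsUnit (f : QWeylAlgebra q) := fun hu => hf.not_isUnit (isUnit_of_isUnit_coe hu)
    refine ⟨hu, fun a b hab => ?_⟩
    by_contra! hc
    obtain ⟨i, hi | hi⟩ := (monic_irreducible_isReducible_iff m f).1
      ⟨hm, hf, isReducible_of_mul hk.ne_zero hu hc.1 hc.2 hab⟩
    · exact h ⟨i, hi⟩
    · exact h' ⟨i, hi⟩

theorem factorization_of_mem_gradedPart_zero (m : MonomialOrder (Fin n)) {p : QWeylAlgebra q}
    (hp : p ∈ gradedPart q 0) : p ∈ thetaAlgebra q ∧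
      (p ≠ 0 → ∃ c L, IsThetaFactorization q m p c L) ∧
      (∀ c L, IsThetaFactorization q m p c L →
        p = (c * (L.map (rewriteScalar q)).prod) • (L.flatMap (rewriteFactor q)).prod ∧
        ∀ g ∈ L.flatMap (rewriteFactor q), Irreducible g) := by
  have hp' : p ∈ thetaAlgebra q := gradedPart_zero_le hp
  refine ⟨hp', fun h0 => ?_, fun c L ⟨_, hL, hprod⟩ => ⟨?_, fun g hg => ?_⟩⟩
  · obtain ⟨P, rfl⟩ := exists_thetaHom_eq q hp'
    exact exists_isThetaFactorization m fun h => h0 (by rw [h, map_zero])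
  · rw [hprod, coe_prod_eq_smul_prod_flatMap, smul_smul]
  · obtain ⟨f, hf, hgf⟩ := List.mem_flatMap.1 hg
    exact irreducible_of_mem_rewriteFactor (hL f hf).1 (hL f hf).2 hgf

theorem rewriteScalar_weylParam (f : thetaAlgebra (weylParam K n)) :
    rewriteScalar (weylParam K n) f = 1 := by
  unfold rewriteScalar
  split_ifs <;> simp

end QWeylAlgebra

open QWeylAlgebra in
theorem mainTheorem1 {K : Type*} [Field K] [CharZero K] {n : ℕ} (q : Fin n → Kˣ)
    (m : MonomialOrder (Fin n)) :
    -- the monic irreducible elements of `K[θ]` that are reducible in `Q_n`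
    ({f : thetaAlgebra q |
        IsThetaMonic q m f ∧ Irreducible f ∧ IsReducible (f : QWeylAlgebra q)} =
      {f | ∃ i, f = thetaGen q i ∨
        f = thetaGen q i + algebraMap K (thetaAlgebra q) (1 / (q i : K))}) ∧
    -- the monic irreducible elements of `K[θ]` that are reducible in `A_n`
    ({f : thetaAlgebra (weylParam K n) |
        IsThetaMonic (weylParam K n) m f ∧ Irreducible f ∧
          IsReducible (f : QWeylAlgebra (weylParam K n))} =
      {f | ∃ i, f = thetaGen (weylParam K n) i ∨ f = thetaGen (weylParam K n) i + 1}) ∧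
    -- the rewriting rules in `Q_n` and in `A_n`
    (∀ i, theta q i = x q i * d q i ∧
      theta q i + algebraMap K (QWeylAlgebra q) (1 / (q i : K)) =
        (1 / (q i : K)) • (d q i * x q i)) ∧
    (∀ i, theta (weylParam K n) i = x (weylParam K n) i * d (weylParam K n) i ∧
      theta (weylParam K n) i + 1 = d (weylParam K n) i * x (weylParam K n) i) ∧
    -- factorization of homogeneous elements of degree `0` in `Q_n`
    (∀ p ∈ gradedPart q 0, p ∈ thetaAlgebra q ∧
      (p ≠ 0 → ∃ c L, IsThetaFactorization q m p c L) ∧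
      (∀ c L, IsThetaFactorization q m p c L →
        p = (c * (L.map (rewriteScalar q)).prod) • (L.flatMap (rewriteFactor q)).prod ∧
        ∀ g ∈ L.flatMap (rewriteFactor q), Irreducible g)) ∧
    -- factorization of homogeneous elements of degree `0` in `A_n`
    (∀ p ∈ gradedPart (weylParam K n) 0, p ∈ thetaAlgebra (weylParam K n) ∧
      (p ≠ 0 → ∃ c L, IsThetaFactorization (weylParam K n) m p c L) ∧
      (∀ c L, IsThetaFactorization (weylParam K n) m p c L →
        p = c • (L.flatMap (rewriteFactor (weylParam K n))).prod ∧
        ∀ g ∈ L.flatMap (rewriteFactor (weylParam K n)), Irreducible g)) := by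
  have hshift : ∀ i, thetaShift (weylParam K n) i = thetaGen (weylParam K n) i + 1 := fun i => by
    simp [thetaShift]
  refine ⟨Set.ext fun f => monic_irreducible_isReducible_iff m f, Set.ext fun f => ?_,
    fun i => ⟨rfl, theta_add_eq i⟩, fun i => ⟨rfl, ?_⟩,
    fun p hp => factorization_of_mem_gradedPart_zero m hp, fun p hp => ?_⟩
  · simpa only [hshift, Set.mem_ofPred_eq] using monic_irreducible_isReducible_iff m f
  · simpa using theta_add_eq (q := weylParam K n) i
  · obtain ⟨h1, h2, h3⟩ := factorization_of_mem_gradedPart_zero m hp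
    refine ⟨h1, h2, fun c L hL => ⟨(h3 c L hL).1.trans ?_, (h3 c L hL).2⟩⟩
    rw [List.prod_eq_one, mul_one]
    intro s hs
    obtain ⟨f, -, rfl⟩ := List.mem_map.1 hs
    exact rewriteScalar_weylParam f
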